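/- Let $(\Omega,\mathscr F,P)$ be a probability space with a filtration $(\mathscr F_t)_{t\ge 0}$ satisfying the usual conditions (right-continuous, and $\mathscr F_0$ contains all subsets of $P$-null sets). For the firms $i=1,2$ let $\pi^{0i},\pi^{Fi},\pi^{Bi}$ be real-valued, product-measurable, $P\otimes dt$-integrable processes on $\Omega\times[0,\infty)$ (firm $i$'s discounted revenues while no firm has invested, while only the opponent has invested, and after both have invested, respectively) such that $\int_0^t\pi_s\,ds$ is $\mathscr F_t$-measurable for every $t$ and each of these processes $\pi$. Assume that $\pi^{B2}-\pi^{F2}\le\pi^{B1}-\pi^{F1}$ holds $P\otimes dt$-a.e. For a stopping time $\tau$ with values in $[0,\infty]$ define, up to $P$-null sets, the follower payoff and the payoff of simultaneous investment by $$F^i_\tau=\int_0^\tau\pi^{0i}_s\,ds+\operatorname*{ess\,sup}_{\tau'\ge\tau}E\Bigl[\int_\tau^{\tau'}\pi^{Fi}_s\,ds+\int_{\tau'}^\infty\pi^{Bi}_s\,ds\Bigm|\mathscr F_\tau\Bigr],\qquad M^i_\tau=\int_0^\tau\pi^{0i}_s\,ds+E\Bigl[\int_\tau^\infty\pi^{Bi}_s\,ds\Bigm|\mathscr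 F_\tau\Bigr],$$ where $\tau'$ ranges over the stopping times with $\tau'\ge\tau$ a.s. Then, for every stopping time $\tau$ and $i=1,2$, $F^i_\tau$ is well defined and there is a latest stopping time $\tau^i_F(\tau)\ge\tau$ attaining the essential supremum in $F^i_\tau$ (that is, $\tau'\le\tau^i_F(\tau)$ a.s. for every stopping time $\tau'\ge\tau$ attaining it); and $$\tau^1_F(\tau)\le\tau^2_F(\tau)\quad\text{and}\quad F^1_\tau-M^1_\tau\le F^2_\tau-M^2_\tau\qquad P\text{-a.s.}$$ -/

import Mathlib

open MeasureTheory ProbabilityTheory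
open scoped NNReal ENNReal

noncomputable section

namespace InvestmentGame

variable {Ω : Type*} {m : MeasurableSpace Ω}

/-- The usual conditions: the filtration is right-continuous, and every subset of a `P`-null set
belongs to the initial σ-algebra. (`P s` is the outer measure of an arbitrary set `s`.) -/
structure UsualConditions (P : Measure Ω) (𝓕 : Filtration ℝ≥0 m) : Prop where
  rightContinuous : 𝓕.IsRightContinuous
  complete : ∀ s : Set Ω, P s = 0 → MeasurableSet[𝓕 0] s

/-- Lebesgue measure `dt` on the time domain `ℝ≥0 = [0, ∞)`. -/
def dt : Measure ℝ≥0 := Measure.comap (fun t : ℝ≥0 => (t : ℝ)) volume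

theorem measurableEmbedding_coe : MeasurableEmbedding (fun t : ℝ≥0 => (t : ℝ)) :=
  MeasurableEmbedding.subtype_coe measurableSet_Ici

theorem dt_Ico (a b : ℝ≥0) : dt (Set.Ico a b) = ENNReal.ofReal ((b : ℝ) - a) := by
  have h : (fun t : ℝ≥0 => (t : ℝ)) '' Set.Ico a b = Set.Ico (a : ℝ) b := by
    ext x
    constructor
    · rintro ⟨t, ht, rfl⟩
      exact ⟨NNReal.coe_le_coe.2 ht.1, NNReal.coe_lt_coe.2 ht.2⟩
    · intro hx
      exact ⟨⟨x, a.2.trans hx.1⟩, ⟨hx.1, hx.2⟩, rfl⟩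
  rw [dt, measurableEmbedding_coe.comap_apply, h, Real.volume_Ico]

instance : SigmaFinite dt where
  out' := ⟨{
    set := fun n => Set.Ico 0 (n : ℝ≥0)
    set_mem := fun _ => trivial
    finite := fun n => by rw [dt_Ico]; exact ENNReal.ofReal_lt_top
    spanning := by
      ext t
      obtain ⟨n, hn⟩ := exists_nat_gt t
      exact ⟨fun _ => trivial, fun _ => Set.mem_iUnion.2 ⟨n, zero_le, hn⟩⟩ }⟩

/-- The revenue accrued during the random time interval `[σ, ρ)`, that is `∫_σ^ρ π_s ds`, where
the random times take values in `[0, ∞]`. -/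
def accrued (π : ℝ≥0 → Ω → ℝ) (σ ρ : Ω → WithTop ℝ≥0) (ω : Ω) : ℝ :=
  ∫ s in {s : ℝ≥0 | σ ω ≤ (s : WithTop ℝ≥0) ∧ (s : WithTop ℝ≥0) < ρ ω}, π s ω ∂dt

/-- The standing assumptions on a (discounted) revenue process: it is product-measurable and
`P ⊗ dt`-integrable, and the revenue accrued up to each date is known at that date. -/
structure IsRevenue (P : Measure Ω) (𝓕 : Filtration ℝ≥0 m) (π : ℝ≥0 → Ω → ℝ) : Prop where
  measurable : Measurable (fun x : Ω × ℝ≥0 => π x.2 x.1)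
  integrable : Integrable (fun x : Ω × ℝ≥0 => π x.2 x.1) (P.prod dt)
  adapted : ∀ t : ℝ≥0, Measurable[𝓕 t] (accrued π (fun _ => 0) (fun _ => (t : WithTop ℝ≥0)))

/-- `V` is (a version of) the essential supremum of the family `S` of random variables: the
`P`-a.s. least random variable dominating `P`-a.s. each member of `S`. -/
def IsEssSup (P : Measure Ω) (S : Set (Ω → ℝ)) (V : Ω → ℝ) : Prop :=
  AEMeasurable V P ∧ (∀ X ∈ S, X ≤ᵐ[P] V) ∧
    ∀ W : Ω → ℝ, AEMeasurable W P → (∀ X ∈ S, X ≤ᵐ[P] W) → V ≤ᵐ[P] W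

/-- The conditional expectation `E[∫_τ^σ πF_s ds + ∫_σ^∞ πB_s ds | ℱ_τ]` at `τ` of a follower's
revenues from `τ` on, if the follower invests at `σ`. -/
def followerReward (P : Measure Ω) {𝓕 : Filtration ℝ≥0 m} (πF πB : ℝ≥0 → Ω → ℝ)
    {τ : Ω → WithTop ℝ≥0} (hτ : IsStoppingTime 𝓕 τ) (σ : Ω → WithTop ℝ≥0) : Ω → ℝ :=
  P[fun ω => accrued πF τ σ ω + accrued πB σ (fun _ => ⊤) ω | hτ.measurableSpace]

/-- The rewards of all the stopping times that are available to a follower from `τ` on. -/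
def followerRewards (P : Measure Ω) {𝓕 : Filtration ℝ≥0 m} (πF πB : ℝ≥0 → Ω → ℝ)
    {τ : Ω → WithTop ℝ≥0} (hτ : IsStoppingTime 𝓕 τ) : Set (Ω → ℝ) :=
  {X | ∃ σ : Ω → WithTop ℝ≥0, IsStoppingTime 𝓕 σ ∧ τ ≤ᵐ[P] σ ∧
    X = followerReward P πF πB hτ σ}

/-- `Z` is (a version of) the conditional follower payoff
`F(τ) = ∫_0^τ π0_s ds + ess sup_{σ ≥ τ} E[∫_τ^σ πF_s ds + ∫_σ^∞ πB_s ds | ℱ_τ]`. -/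
def IsFollowerPayoff (P : Measure Ω) {𝓕 : Filtration ℝ≥0 m} (π0 πF πB : ℝ≥0 → Ω → ℝ)
    {τ : Ω → WithTop ℝ≥0} (hτ : IsStoppingTime 𝓕 τ) (Z : Ω → ℝ) : Prop :=
  ∃ V : Ω → ℝ, IsEssSup P (followerRewards P πF πB hτ) V ∧
    Z =ᵐ[P] fun ω => accrued π0 (fun _ => 0) τ ω + V ω

/-- The conditional payoff of simultaneous investment at `τ`,
`M(τ) = ∫_0^τ π0_s ds + E[∫_τ^∞ πB_s ds | ℱ_τ]`. -/
def simultaneousPayoff (P : Measure Ω) {𝓕 : Filtration ℝ≥0 m} (π0 πB : ℝ≥0 → Ω → ℝ)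
    {τ : Ω → WithTop ℝ≥0} (hτ : IsStoppingTime 𝓕 τ) (ω : Ω) : ℝ :=
  accrued π0 (fun _ => 0) τ ω + (P[accrued πB τ (fun _ => ⊤) | hτ.measurableSpace]) ω

/-- `σ` is an optimal stopping time for a follower from `τ` on: it attains the essential supremum
in the follower payoff. -/
def IsOptimalFollowerTime (P : Measure Ω) {𝓕 : Filtration ℝ≥0 m} (πF πB : ℝ≥0 → Ω → ℝ)
    {τ : Ω → WithTop ℝ≥0} (hτ : IsStoppingTime 𝓕 τ) (σ : Ω → WithTop ℝ≥0) : Prop :=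
  IsStoppingTime 𝓕 σ ∧ τ ≤ᵐ[P] σ ∧
    IsEssSup P (followerRewards P πF πB hτ) (followerReward P πF πB hτ σ)

/-- `σ` is (a version of) the latest optimal stopping time for a follower from `τ` on. -/
def IsLatestFollowerTime (P : Measure Ω) {𝓕 : Filtration ℝ≥0 m} (πF πB : ℝ≥0 → Ω → ℝ)
    {τ : Ω → WithTop ℝ≥0} (hτ : IsStoppingTime 𝓕 τ) (σ : Ω → WithTop ℝ≥0) : Prop :=
  IsOptimalFollowerTime P πF πB hτ σ ∧
    ∀ σ' : Ω → WithTop ℝ≥0, IsOptimalFollowerTime P πF πB hτ σ' → σ' ≤ᵐ[P] σ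

end InvestmentGame

end

/-! Investing at `σ` instead of `τ` adds `πF - πB` on `[τ, σ)`, so the follower maximizes, up to a
term independent of `σ`, the integral of `delayFlow` over the region `before σ`. Maxima and minima
of times become unions and intersections of regions, so the expected gain is modular
(`gain_sup_add_gain_inf`). Modularity makes a lower limit of nearly optimal times optimal
(`exists_isMaximal`), keeps optimal times closed under maxima, and yields a latest one
(`exists_greatest_isMaximal`).

Maximality in expectation is equivalent to attaining the essential supremum, by pasting along events
of `ℱ_τ` (`IsMaximal.condExp_total_le`). Firm 2 has the larger delay flow, so it stops later
(`IsMaximal.sup_of_le`) and its option to delay is worth more. -/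

noncomputable section

namespace InvestmentGame

open Filter Topology

variable {Ω : Type*} {m : MeasurableSpace Ω} {P : Measure Ω} {𝓕 : Filtration ℝ≥0 m}

/-! ### Stopping times as regions of the product space -/

/-- The points `(ω, s)` of the product space with `s < σ ω`. -/
def before (σ : Ω → WithTop ℝ≥0) : Set (Ω × ℝ≥0) := {x | (x.2 : WithTop ℝ≥0) < σ x.1}

/-- The expected total of `H` up to the random time `σ`. -/
def gain (P : Measure Ω) (H : Ω × ℝ≥0 → ℝ) (σ : Ω → WithTop ℝ≥0) : ℝ :=
  ∫ x in before σ, H x ∂(P.prod dt)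

/-- The stopping times that are available from `τ` on. -/
def IsAvailable (P : Measure Ω) (𝓕 : Filtration ℝ≥0 m) (τ σ : Ω → WithTop ℝ≥0) : Prop :=
  IsStoppingTime 𝓕 σ ∧ τ ≤ᵐ[P] σ

/-- `σ` maximizes the expected total of `H` among the stopping times available from `τ` on. -/
def IsMaximal (P : Measure Ω) (𝓕 : Filtration ℝ≥0 m) (H : Ω × ℝ≥0 → ℝ)
    (τ σ : Ω → WithTop ℝ≥0) : Prop :=
  IsAvailable P 𝓕 τ σ ∧ ∀ ρ, IsAvailable P 𝓕 τ ρ → gain P H ρ ≤ gain P H σ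

theorem measurableSet_before {σ : Ω → WithTop ℝ≥0} (hσ : IsStoppingTime 𝓕 σ) :
    MeasurableSet (before σ) :=
  measurableSet_lt (WithTop.measurable_coe.comp measurable_snd) (hσ.measurable'.comp measurable_fst)

theorem before_sup (σ ρ : Ω → WithTop ℝ≥0) : before (σ ⊔ ρ) = before σ ∪ before ρ :=
  Set.ext fun x => lt_max_iff (a := (x.2 : WithTop ℝ≥0)) (b := σ x.1) (c := ρ x.1)

theorem before_inf (σ ρ : Ω → WithTop ℝ≥0) : before (σ ⊓ ρ) = before σ ∩ before ρ :=
  Set.ext fun x => lt_min_iff (a := (x.2 : WithTop ℝ≥0)) (b := σ x.1) (c := ρ x.1)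

theorem before_mono {σ ρ : Ω → WithTop ℝ≥0} (h : σ ≤ ρ) : before σ ⊆ before ρ :=
  fun x hx => lt_of_lt_of_le hx (h x.1)

instance : NullSingletonClass dt where
  measure_singleton a := by
    rw [dt, measurableEmbedding_coe.comap_apply]; simp

/-- Each section of the graph has at most one point, and `dt` has no atoms. -/
theorem ae_ne_time [SFinite P] {σ : Ω → WithTop ℝ≥0} (hσ : IsStoppingTime 𝓕 σ) :
    ∀ᵐ x ∂(P.prod dt), (x.2 : WithTop ℝ≥0) ≠ σ x.1 := by
  have hs : MeasurableSet {x : Ω × ℝ≥0 | (x.2 : WithTop ℝ≥0) = σ x.1} :=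
    measurableSet_eq_fun (WithTop.measurable_coe.comp measurable_snd)
      (hσ.measurable'.comp measurable_fst)
  have h : (P.prod dt) {x : Ω × ℝ≥0 | (x.2 : WithTop ℝ≥0) = σ x.1} = 0 := by
    rw [Measure.measure_prod_null hs]
    filter_upwards with ω
    refine Set.Subsingleton.measure_zero (fun s hs t ht => ?_) dt
    exact WithTop.coe_injective (Eq.trans hs (Eq.symm ht))
  rw [ae_iff]
  simpa using h

theorem isStoppingTime_iSup {σ : ℕ → Ω → WithTop ℝ≥0} (hσ : ∀ n, IsStoppingTime 𝓕 (σ n)) :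
    IsStoppingTime 𝓕 (⨆ n, σ n) := by
  intro t
  have : {ω | (⨆ n, σ n) ω ≤ (t : WithTop ℝ≥0)} = ⋂ n, {ω | σ n ω ≤ t} := by
    ext ω
    simp only [Set.mem_ofPred_eq, Set.mem_iInter, iSup_apply]
    exact iSup_le_iff
  rw [this]
  exact MeasurableSet.iInter fun n => hσ n t

theorem isStoppingTime_iInf (h𝓕 : 𝓕.IsRightContinuous) {σ : ℕ → Ω → WithTop ℝ≥0}
    (hσ : ∀ n, IsStoppingTime 𝓕 (σ n)) : IsStoppingTime 𝓕 (⨅ n, σ n) := by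
  have := h𝓕
  have := IsStoppingTime.iInf hσ
  convert this using 1
  ext ω; simp [iInf_apply]

theorem IsAvailable.sup {τ σ ρ : Ω → WithTop ℝ≥0} (hσ : IsAvailable P 𝓕 τ σ)
    (hρ : IsAvailable P 𝓕 τ ρ) : IsAvailable P 𝓕 τ (σ ⊔ ρ) :=
  ⟨hσ.1.max hρ.1, hσ.2.mono fun _ h => h.trans le_sup_left⟩

theorem IsAvailable.inf {τ σ ρ : Ω → WithTop ℝ≥0} (hσ : IsAvailable P 𝓕 τ σ)
    (hρ : IsAvailable P 𝓕 τ ρ) : IsAvailable P 𝓕 τ (σ ⊓ ρ) :=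
  ⟨hσ.1.min hρ.1, by filter_upwards [hσ.2, hρ.2] with ω h₁ h₂ using le_inf h₁ h₂⟩

theorem IsAvailable.iSup {τ : Ω → WithTop ℝ≥0} {σ : ℕ → Ω → WithTop ℝ≥0}
    (hσ : ∀ n, IsAvailable P 𝓕 τ (σ n)) : IsAvailable P 𝓕 τ (⨆ n, σ n) :=
  ⟨isStoppingTime_iSup fun n => (hσ n).1, (hσ 0).2.mono fun ω h => h.trans (le_iSup σ 0 ω)⟩

theorem IsAvailable.iInf (h𝓕 : 𝓕.IsRightContinuous) {τ : Ω → WithTop ℝ≥0}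
    {σ : ℕ → Ω → WithTop ℝ≥0} (hσ : ∀ n, IsAvailable P 𝓕 τ (σ n)) :
    IsAvailable P 𝓕 τ (⨅ n, σ n) := by
  refine ⟨isStoppingTime_iInf h𝓕 fun n => (hσ n).1, ?_⟩
  filter_upwards [ae_all_iff.2 fun n => (hσ n).2] with ω h
  rw [iInf_apply]
  exact le_iInf h

theorem gain_sup_add_gain_inf {H : Ω × ℝ≥0 → ℝ} (hH : Integrable H (P.prod dt))
    {σ ρ : Ω → WithTop ℝ≥0} (hσ : IsStoppingTime 𝓕 σ) (hρ : IsStoppingTime 𝓕 ρ) :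
    gain P H (σ ⊔ ρ) + gain P H (σ ⊓ ρ) = gain P H σ + gain P H ρ := by
  have hs := measurableSet_before hσ
  have ht := measurableSet_before hρ
  rw [gain, gain, gain, gain, before_sup, before_inf, ← Set.sdiff_union_self,
    setIntegral_union Set.disjoint_sdiff_left ht hH.integrableOn hH.integrableOn,
    ← integral_inter_add_sdiff (s := before σ) ht hH.integrableOn]
  ring

theorem tendsto_gain_iSup {H : Ω × ℝ≥0 → ℝ} (hH : Integrable H (P.prod dt))
    {σ : ℕ → Ω → WithTop ℝ≥0} (hσ : ∀ n, IsStoppingTime 𝓕 (σ n)) (hmono : Monotone σ) :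
    Tendsto (fun n => gain P H (σ n)) atTop (𝓝 (gain P H (⨆ n, σ n))) := by
  have h : before (⨆ n, σ n) = ⋃ n, before (σ n) := by
    ext x
    simp only [before, Set.mem_ofPred_eq, Set.mem_iUnion, iSup_apply]
    exact lt_iSup_iff
  rw [gain, h]
  exact tendsto_setIntegral_of_monotone (fun n => measurableSet_before (hσ n))
    (fun _ _ hab => before_mono (hmono hab)) hH.integrableOn

theorem tendsto_gain_iInf [SFinite P] (h𝓕 : 𝓕.IsRightContinuous) {H : Ω × ℝ≥0 → ℝ}
    (hH : Integrable H (P.prod dt)) {σ : ℕ → Ω → WithTop ℝ≥0}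
    (hσ : ∀ n, IsStoppingTime 𝓕 (σ n)) (hanti : Antitone σ) :
    Tendsto (fun n => gain P H (σ n)) atTop (𝓝 (gain P H (⨅ n, σ n))) := by
  -- A point below every `σ n` is only weakly below the infimum; the exceptions lie on its graph, a
  -- null set.
  have h : before (⨅ n, σ n) =ᵐ[P.prod dt] ⋂ n, before (σ n) := by
    filter_upwards [ae_ne_time (isStoppingTime_iInf h𝓕 hσ)] with x hx
    refine propext ⟨fun h => Set.mem_iInter.2 fun n => before_mono (iInf_le σ n) h, fun h => ?_⟩
    refine lt_of_le_of_ne ?_ hx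
    rw [iInf_apply]
    exact le_iInf fun n => (Set.mem_iInter.1 h n).le
  rw [gain, setIntegral_congr_set h]
  exact tendsto_setIntegral_of_antitone (fun n => measurableSet_before (hσ n))
    (fun _ _ hab => before_mono (hanti hab)) ⟨0, hH.integrableOn⟩

theorem gain_le_integral_abs {H : Ω × ℝ≥0 → ℝ} (hH : Integrable H (P.prod dt))
    (σ : Ω → WithTop ℝ≥0) : gain P H σ ≤ ∫ x, |H x| ∂(P.prod dt) :=
  (le_abs_self _).trans <| (abs_integral_le_integral_abs).trans <|
    setIntegral_le_integral hH.abs (Eventually.of_forall fun _ => abs_nonneg _)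

theorem isAvailable_self {τ : Ω → WithTop ℝ≥0} (hτ : IsStoppingTime 𝓕 τ) :
    IsAvailable P 𝓕 τ τ := ⟨hτ, ae_of_all _ fun _ => le_rfl⟩

/-! ### Existence of a maximal time -/

/-- The infimum of the times `σ k, …, σ (k + j)`. -/
def finInf (σ : ℕ → Ω → WithTop ℝ≥0) : ℕ → ℕ → Ω → WithTop ℝ≥0
  | k, 0 => σ k
  | k, j + 1 => σ k ⊓ finInf σ (k + 1) j

theorem finInf_succ_le (σ : ℕ → Ω → WithTop ℝ≥0) (k j : ℕ) :
    finInf σ k (j + 1) ≤ finInf σ k j := by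
  induction j generalizing k with
  | zero => exact inf_le_left
  | succ j ih => exact inf_le_inf_left _ (ih (k + 1))

theorem IsAvailable.finInf {τ : Ω → WithTop ℝ≥0} {σ : ℕ → Ω → WithTop ℝ≥0}
    (hσ : ∀ n, IsAvailable P 𝓕 τ (σ n)) (k j : ℕ) :
    IsAvailable P 𝓕 τ (InvestmentGame.finInf σ k j) := by
  induction j generalizing k with
  | zero => exact hσ k
  | succ j ih => exact (hσ k).inf (ih (k + 1))

/-- As the gain of a supremum is at most `v`, modularity makes the shortfall of an infimum at most
the sum of the shortfalls. Here that sum is `∑ (1/2)^i` over `k ≤ i ≤ k + j`. -/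
theorem le_gain_finInf {H : Ω × ℝ≥0 → ℝ} (hH : Integrable H (P.prod dt))
    {τ : Ω → WithTop ℝ≥0} {v : ℝ} (hv : ∀ ρ, IsAvailable P 𝓕 τ ρ → gain P H ρ ≤ v)
    {σ : ℕ → Ω → WithTop ℝ≥0} (hσ : ∀ n, IsAvailable P 𝓕 τ (σ n))
    (hσv : ∀ n, v - (1 / 2) ^ n ≤ gain P H (σ n)) (k j : ℕ) :
    v - 2 * (1 / 2) ^ k + (1 / 2) ^ (k + j) ≤ gain P H (finInf σ k j) := by
  induction j generalizing k with
  | zero => have := hσv k; simp only [finInf, add_zero]; linarith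
  | succ j ih =>
    have hav := IsAvailable.finInf hσ (k + 1) j
    have h := gain_sup_add_gain_inf hH (hσ k).1 hav.1
    have h₁ := hv _ ((hσ k).sup hav)
    have h₂ := ih (k + 1)
    have h₃ := hσv k
    rw [show k + 1 + j = k + (j + 1) by ring, pow_succ (1 / 2 : ℝ) k] at h₂
    simp only [finInf]
    linarith

/-- Because the gain is modular, the lower limit of nearly optimal times is optimal. -/
theorem exists_isMaximal [SFinite P] (h𝓕 : 𝓕.IsRightContinuous) {H : Ω × ℝ≥0 → ℝ}
    (hH : Integrable H (P.prod dt)) {τ : Ω → WithTop ℝ≥0} (hτ : IsStoppingTime 𝓕 τ) :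
    ∃ σ, IsMaximal P 𝓕 H τ σ := by
  set S : Set ℝ := gain P H '' {ρ | IsAvailable P 𝓕 τ ρ}
  have hne : S.Nonempty := ⟨_, τ, isAvailable_self hτ, rfl⟩
  have hbdd : BddAbove S :=
    ⟨_, by rintro _ ⟨ρ, -, rfl⟩; exact gain_le_integral_abs hH ρ⟩
  have hv : ∀ ρ, IsAvailable P 𝓕 τ ρ → gain P H ρ ≤ sSup S :=
    fun ρ hρ => le_csSup hbdd ⟨ρ, hρ, rfl⟩
  have hex : ∀ n : ℕ, ∃ σ, IsAvailable P 𝓕 τ σ ∧ sSup S - (1 / 2) ^ n ≤ gain P H σ := by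
    intro n
    obtain ⟨_, ⟨σ, hσ, rfl⟩, h⟩ :=
      exists_lt_of_lt_csSup hne (sub_lt_self (sSup S) (show (0 : ℝ) < (1 / 2) ^ n by positivity))
    exact ⟨σ, hσ, h.le⟩
  choose σ hσ hσv using hex
  have hρ : ∀ k, IsAvailable P 𝓕 τ (⨅ j, finInf σ k j) :=
    fun k => IsAvailable.iInf h𝓕 fun j => IsAvailable.finInf hσ k j
  have hρmono : Monotone fun k => ⨅ j, finInf σ k j :=
    monotone_nat_of_le_succ fun k => le_iInf fun j => (iInf_le _ (j + 1)).trans inf_le_right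
  have hρv : ∀ k, sSup S - 2 * (1 / 2) ^ k ≤ gain P H (⨅ j, finInf σ k j) := by
    intro k
    refine ge_of_tendsto (tendsto_gain_iInf h𝓕 hH (fun j => (IsAvailable.finInf hσ k j).1)
      (antitone_nat_of_succ_le (finInf_succ_le σ k))) (Eventually.of_forall fun j => ?_)
    have := le_gain_finInf hH hv hσ hσv k j
    have : (0 : ℝ) < (1 / 2) ^ (k + j) := by positivity
    linarith
  -- The witness is `⨆ k, ⨅ j, finInf σ k j`, the lower limit of `σ`.
  refine ⟨_, IsAvailable.iSup hρ, fun ρ' hρ' => (hv ρ' hρ').trans ?_⟩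
  have hlim : Tendsto (fun k : ℕ => sSup S - 2 * (1 / 2 : ℝ) ^ k) atTop (𝓝 (sSup S)) := by
    have := (tendsto_pow_atTop_nhds_zero_of_lt_one (r := (1 / 2 : ℝ)) (by norm_num)
      (by norm_num)).const_mul 2 |>.const_sub (sSup S)
    simpa using this
  exact le_of_tendsto_of_tendsto' hlim (tendsto_gain_iSup hH (fun k => (hρ k).1) hρmono) hρv

/-! ### The latest maximal time and its monotonicity in the flow -/

/-- The infimum gains at most as much as `σ`, so by modularity the supremum gains at least as much
as `ρ`. -/
theorem IsMaximal.sup {H : Ω × ℝ≥0 → ℝ} (hH : Integrable H (P.prod dt))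
    {τ σ ρ : Ω → WithTop ℝ≥0} (hσ : IsMaximal P 𝓕 H τ σ) (hρ : IsMaximal P 𝓕 H τ ρ) :
    IsMaximal P 𝓕 H τ (σ ⊔ ρ) := by
  refine ⟨hσ.1.sup hρ.1, fun ρ' hρ' => ?_⟩
  have h := gain_sup_add_gain_inf hH hσ.1.1 hρ.1.1
  have h₁ := hσ.2 _ (hσ.1.inf hρ.1)
  have h₂ := hρ.2 ρ' hρ'
  linarith

theorem ae_le_of_measure_before_sdiff [SFinite P] {σ ρ : Ω → WithTop ℝ≥0}
    (hσ : IsStoppingTime 𝓕 σ) (hρ : IsStoppingTime 𝓕 ρ)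
    (h : (P.prod dt) (before σ \ before ρ) = 0) : σ ≤ᵐ[P] ρ := by
  rw [Measure.measure_prod_null ((measurableSet_before hσ).diff (measurableSet_before hρ))] at h
  filter_upwards [h] with ω hω
  by_contra! hlt
  lift ρ ω to ℝ≥0 using ne_top_of_lt hlt with a ha
  -- `σ ω` may be `⊤`; an intermediate finite `c` gives an interval of positive length in the
  -- section.
  obtain ⟨c, hac, hcσ⟩ := exists_between hlt
  lift c to ℝ≥0 using ne_top_of_lt hcσ
  have hsub : Set.Ico a c ⊆ Prod.mk ω ⁻¹' (before σ \ before ρ) := fun s hs =>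
    ⟨lt_trans (WithTop.coe_lt_coe.2 hs.2) hcσ,
      not_lt.2 (ha.symm.trans_le (WithTop.coe_le_coe.2 hs.1))⟩
  have hpos : 0 < dt (Set.Ico a c) := by
    rw [dt_Ico, ENNReal.ofReal_pos, sub_pos]
    exact NNReal.coe_lt_coe.2 (WithTop.coe_lt_coe.1 hac)
  exact absurd (measure_mono_null hsub hω) hpos.ne'

/-- Among maximal times, one maximizes the gain of a strictly positive integrable weight `g`. Its
supremum with any other maximal time has no more weight, so it adds only a null region. -/
theorem exists_greatest_isMaximal [SigmaFinite P] (h𝓕 : 𝓕.IsRightContinuous)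
    {H : Ω × ℝ≥0 → ℝ} (hH : Integrable H (P.prod dt)) {τ : Ω → WithTop ℝ≥0}
    (hτ : IsStoppingTime 𝓕 τ) :
    ∃ σ, IsMaximal P 𝓕 H τ σ ∧ ∀ ρ, IsMaximal P 𝓕 H τ ρ → ρ ≤ᵐ[P] σ := by
  obtain ⟨g, hgpos, hgm, hgint⟩ :=
    exists_pos_lintegral_lt_of_sigmaFinite (P.prod dt) (ε := 1) one_ne_zero
  have hw : Integrable (fun x => (g x : ℝ)) (P.prod dt) :=
    ⟨hgm.coe_nnreal_real.aestronglyMeasurable, by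
      simpa [HasFiniteIntegral, enorm_eq_nnnorm] using hgint.trans ENNReal.one_lt_top⟩
  set w : Ω × ℝ≥0 → ℝ := fun x => g x
  set S : Set ℝ := gain P w '' {ρ | IsMaximal P 𝓕 H τ ρ}
  obtain ⟨σ₀, hσ₀⟩ := exists_isMaximal h𝓕 hH hτ
  have hne : S.Nonempty := ⟨_, σ₀, hσ₀, rfl⟩
  have hbdd : BddAbove S :=
    ⟨_, by rintro _ ⟨ρ, -, rfl⟩; exact gain_le_integral_abs hw ρ⟩
  obtain ⟨u, -, hu, huS⟩ := exists_seq_tendsto_sSup hne hbdd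
  choose σ hσ hσu using huS
  have hmax : ∀ n, IsMaximal P 𝓕 H τ (partialSups σ n) := by
    intro n
    induction n with
    | zero => simpa using hσ 0
    | succ n ih => rw [partialSups_add_one]; exact ih.sup hH (hσ (n + 1))
  have hst := fun n => (hmax n).1.1
  have hmono : Monotone fun n => partialSups σ n := (partialSups σ).monotone
  have hlimmax : IsMaximal P 𝓕 H τ (⨆ n, partialSups σ n) := by
    refine ⟨IsAvailable.iSup fun n => (hmax n).1, fun ρ hρ => ?_⟩
    exact ge_of_tendsto (tendsto_gain_iSup hH hst hmono)
      (Eventually.of_forall fun n => (hmax n).2 ρ hρ)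
  have hgainmono : ∀ {α β : Ω → WithTop ℝ≥0}, α ≤ β → gain P w α ≤ gain P w β :=
    fun h => setIntegral_mono_set hw.integrableOn
      (Eventually.of_forall fun x => (g x).2) (before_mono h).eventuallyLE
  have hsup : sSup S ≤ gain P w (⨆ n, partialSups σ n) :=
    le_of_tendsto' hu fun n => by
      rw [← hσu n]
      exact hgainmono ((le_partialSups σ n).trans (le_iSup (fun n => partialSups σ n) n))
  refine ⟨_, hlimmax, fun ρ hρ => ?_⟩
  set L := ⨆ n, partialSups σ n
  have hle : gain P w (ρ ⊔ L) ≤ gain P w L :=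
    (le_csSup hbdd ⟨_, hρ.sup hH hlimmax, rfl⟩).trans hsup
  have hmL := measurableSet_before hlimmax.1.1
  rw [gain, gain, before_sup, ← Set.sdiff_union_self,
    setIntegral_union Set.disjoint_sdiff_left hmL hw.integrableOn hw.integrableOn] at hle
  have hzero : ∫ x in before ρ \ before L, w x ∂(P.prod dt) = 0 :=
    le_antisymm (by linarith) (integral_nonneg fun x => (g x).2)
  refine ae_le_of_measure_before_sdiff hρ.1.1 hlimmax.1.1 ?_
  rw [setIntegral_eq_zero_iff_of_nonneg_ae (Eventually.of_forall fun x => by exact (g x).2)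
    hw.integrableOn] at hzero
  have hfalse : ∀ᵐ x ∂((P.prod dt).restrict (before ρ \ before L)), False := by
    filter_upwards [hzero] with x hx
    exact (NNReal.coe_pos.2 (hgpos x)).ne' hx
  simpa [ae_iff] using hfalse

/-- A larger flow makes stopping later optimal. -/
theorem IsMaximal.sup_of_le {H₁ H₂ : Ω × ℝ≥0 → ℝ} (hH₁ : Integrable H₁ (P.prod dt))
    (hH₂ : Integrable H₂ (P.prod dt)) (hle : H₁ ≤ᵐ[P.prod dt] H₂)
    {τ σ₁ σ₂ : Ω → WithTop ℝ≥0} (h₁ : IsMaximal P 𝓕 H₁ τ σ₁) (h₂ : IsMaximal P 𝓕 H₂ τ σ₂) :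
    IsMaximal P 𝓕 H₂ τ (σ₁ ⊔ σ₂) := by
  refine ⟨h₁.1.sup h₂.1, fun ρ hρ => (h₂.2 ρ hρ).trans ?_⟩
  have hs := measurableSet_before h₁.1.1
  have ht := measurableSet_before h₂.1.1
  -- Testing `σ₁` against `σ₁ ⊓ σ₂` shows that `H₁`, hence `H₂`, has nonnegative integral over
  -- `before σ₁ \ before σ₂`.
  have hinf := h₁.2 _ (h₁.1.inf h₂.1)
  rw [gain, gain, before_inf, ← integral_inter_add_sdiff (s := before σ₁) ht hH₁.integrableOn]
    at hinf
  have hmono := setIntegral_mono_ae (s := before σ₁ \ before σ₂) hH₁.integrableOn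
    hH₂.integrableOn hle
  rw [gain, gain, before_sup, ← Set.sdiff_union_self (s := before σ₁),
    setIntegral_union Set.disjoint_sdiff_left ht hH₂.integrableOn hH₂.integrableOn]
  linarith

/-! ### From expectations to conditional expectations -/

/-- The total of `H` up to the random time `σ`. -/
def total (H : Ω × ℝ≥0 → ℝ) (σ : Ω → WithTop ℝ≥0) (ω : Ω) : ℝ :=
  ∫ s, (before σ).indicator H (ω, s) ∂dt

theorem integrable_total [SFinite P] {H : Ω × ℝ≥0 → ℝ} (hH : Integrable H (P.prod dt))
    {σ : Ω → WithTop ℝ≥0} (hσ : IsStoppingTime 𝓕 σ) : Integrable (total H σ) P :=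
  (hH.indicator (measurableSet_before hσ)).integral_prod_left

theorem integral_total [SFinite P] {H : Ω × ℝ≥0 → ℝ} (hH : Integrable H (P.prod dt))
    {σ : Ω → WithTop ℝ≥0} (hσ : IsStoppingTime 𝓕 σ) : ∫ ω, total H σ ω ∂P = gain P H σ := by
  rw [gain, ← integral_indicator (measurableSet_before hσ),
    integral_prod _ (hH.indicator (measurableSet_before hσ))]
  rfl

theorem total_congr {H : Ω × ℝ≥0 → ℝ} {σ ρ : Ω → WithTop ℝ≥0} {ω : Ω} (h : σ ω = ρ ω) :
    total H σ ω = total H ρ ω := by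
  have hmem : ∀ s, (ω, s) ∈ before σ ↔ (ω, s) ∈ before ρ := fun s => by
    simp only [before, Set.mem_ofPred_eq, h]
  refine integral_congr_ae (ae_of_all _ fun s => ?_)
  by_cases hs : (ω, s) ∈ before ρ
  · simp [hs, (hmem s).2 hs]
  · simp [hs, mt (hmem s).1 hs]

/-- The choice is known at `τ`, before either time can occur. -/
theorem isStoppingTime_piecewise {τ σ ρ : Ω → WithTop ℝ≥0} (hτ : IsStoppingTime 𝓕 τ)
    (hσ : IsStoppingTime 𝓕 σ) (hρ : IsStoppingTime 𝓕 ρ) (hτσ : τ ≤ σ) (hτρ : τ ≤ ρ)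
    {A : Set Ω} [DecidablePred (· ∈ A)] (hA : MeasurableSet[hτ.measurableSpace] A) :
    IsStoppingTime 𝓕 (A.piecewise σ ρ) := by
  intro t
  have hAc : MeasurableSet[hτ.measurableSpace] Aᶜ := hA.compl
  have h : {ω | A.piecewise σ ρ ω ≤ (t : WithTop ℝ≥0)} =
      ((A ∩ {ω | τ ω ≤ t}) ∩ {ω | σ ω ≤ t}) ∪ ((Aᶜ ∩ {ω | τ ω ≤ t}) ∩ {ω | ρ ω ≤ t}) := by
    ext ω
    have h₁ := hτσ ω
    have h₂ := hτρ ω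
    by_cases hω : ω ∈ A
    · simpa [hω] using fun h => h₁.trans h
    · simpa [hω] using fun h => h₂.trans h
  rw [h]
  exact ((hA.2 t).inter (hσ t)).union ((hAc.2 t).inter (hρ t))

/-- For `A` in `ℱ_τ`, following `ρ` on `A` and `σ` off `A` cannot beat `σ`; the parts off `A`
cancel, leaving the inequality of integrals over `A`. -/
theorem IsMaximal.condExp_total_le [IsFiniteMeasure P] {H : Ω × ℝ≥0 → ℝ}
    (hH : Integrable H (P.prod dt)) {τ σ ρ : Ω → WithTop ℝ≥0} (hτ : IsStoppingTime 𝓕 τ)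
    (hσ : IsMaximal P 𝓕 H τ σ) (hρ : IsAvailable P 𝓕 τ ρ) :
    P[total H ρ | hτ.measurableSpace] ≤ᵐ[P] P[total H σ | hτ.measurableSpace] := by
  classical
  have hm := hτ.measurableSpace_le
  have hiσ := integrable_total hH hσ.1.1
  have hiρ := integrable_total hH hρ.1
  refine ae_le_of_ae_le_trim (hm := hm) ?_
  refine ae_le_of_forall_setIntegral_le
    (integrable_condExp.trim hm stronglyMeasurable_condExp)
    (integrable_condExp.trim hm stronglyMeasurable_condExp) fun A hA _ => ?_
  rw [← setIntegral_trim hm stronglyMeasurable_condExp hA,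
    ← setIntegral_trim hm stronglyMeasurable_condExp hA,
    setIntegral_condExp hm hiρ hA, setIntegral_condExp hm hiσ hA]
  -- Joining with `τ` makes the bounds hold everywhere, as pasting requires, and changes the times
  -- only on null sets.
  have hst : IsStoppingTime 𝓕 (A.piecewise (ρ ⊔ τ) (σ ⊔ τ)) :=
    isStoppingTime_piecewise hτ (hρ.1.max hτ) (hσ.1.1.max hτ) le_sup_right le_sup_right hA
  have hav : IsAvailable P 𝓕 τ (A.piecewise (ρ ⊔ τ) (σ ⊔ τ)) :=
    ⟨hst, ae_of_all _ fun ω => by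
      by_cases hω : ω ∈ A
      · simp [hω]
      · simp [hω]⟩
  have h := hσ.2 _ hav
  rw [← integral_total hH hst, ← integral_total hH hσ.1.1,
    ← integral_add_compl (hm A hA) (integrable_total hH hst),
    ← integral_add_compl (hm A hA) hiσ] at h
  have h₁ : ∫ ω in A, total H (A.piecewise (ρ ⊔ τ) (σ ⊔ τ)) ω ∂P = ∫ ω in A, total H ρ ω ∂P := by
    refine setIntegral_congr_ae (hm A hA) ?_
    filter_upwards [hρ.2] with ω hω hωA
    exact total_congr (by simp [hωA, hω])
  have h₂ : ∫ ω in Aᶜ, total H (A.piecewise (ρ ⊔ τ) (σ ⊔ τ)) ω ∂P =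
      ∫ ω in Aᶜ, total H σ ω ∂P := by
    refine setIntegral_congr_ae (hm A hA).compl ?_
    filter_upwards [hσ.1.2] with ω hω hωA
    exact total_congr (by simp [show ω ∉ A from hωA, hω])
  linarith

/-! ### The follower's problem in terms of the delay flow -/

/-- The revenue flow that a follower gains from `τ` on by delaying investment. -/
def delayFlow (πF πB : ℝ≥0 → Ω → ℝ) (τ : Ω → WithTop ℝ≥0) : Ω × ℝ≥0 → ℝ :=
  (before τ)ᶜ.indicator fun x => πF x.2 x.1 - πB x.2 x.1

theorem integrable_delayFlow {πF πB : ℝ≥0 → Ω → ℝ} (hF : IsRevenue P 𝓕 πF)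
    (hB : IsRevenue P 𝓕 πB) {τ : Ω → WithTop ℝ≥0} (hτ : IsStoppingTime 𝓕 τ) :
    Integrable (delayFlow πF πB τ) (P.prod dt) :=
  (hF.integrable.sub hB.integrable).indicator (measurableSet_before hτ).compl

theorem accrued_eq_setIntegral_sdiff (π : ℝ≥0 → Ω → ℝ) (σ ρ : Ω → WithTop ℝ≥0) (ω : Ω) :
    accrued π σ ρ ω = ∫ s in Prod.mk ω ⁻¹' (before ρ \ before σ), π s ω ∂dt := by
  unfold accrued
  congr 2
  ext s
  exact and_comm.trans (and_congr_right fun _ => not_lt.symm)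

theorem integrable_accrued [SFinite P] {π : ℝ≥0 → Ω → ℝ} (hπ : IsRevenue P 𝓕 π)
    {σ ρ : Ω → WithTop ℝ≥0} (hσ : IsStoppingTime 𝓕 σ) (hρ : IsStoppingTime 𝓕 ρ) :
    Integrable (accrued π σ ρ) P := by
  have hs := (measurableSet_before hρ).diff (measurableSet_before hσ)
  refine (hπ.integrable.indicator hs).integral_prod_left.congr (ae_of_all _ fun ω => ?_)
  change ∫ s, _ ∂dt = _
  rw [accrued_eq_setIntegral_sdiff, ← integral_indicator (measurable_prodMk_left hs)]
  rfl

theorem isStoppingTime_top : IsStoppingTime 𝓕 (fun _ => (⊤ : WithTop ℝ≥0)) := fun t => by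
  simp

/-- Investing at `σ` rather than at `τ` adds the delay flow up to `σ`. -/
theorem accrued_add_accrued_ae_eq [SFinite P] {πF πB : ℝ≥0 → Ω → ℝ} (hF : IsRevenue P 𝓕 πF)
    (hB : IsRevenue P 𝓕 πB) {τ σ : Ω → WithTop ℝ≥0} (hτ : IsStoppingTime 𝓕 τ)
    (hσ : IsAvailable P 𝓕 τ σ) :
    (fun ω => accrued πF τ σ ω + accrued πB σ (fun _ => ⊤) ω) =ᵐ[P]
      accrued πB τ (fun _ => ⊤) + total (delayFlow πF πB τ) σ := by
  filter_upwards [hσ.2, hF.integrable.prod_right_ae, hB.integrable.prod_right_ae]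
    with ω hω hiF hiB
  have hmσ : MeasurableSet (Prod.mk ω ⁻¹' before σ) :=
    measurable_prodMk_left (measurableSet_before hσ.1)
  have hmτ : MeasurableSet (Prod.mk ω ⁻¹' before τ) :=
    measurable_prodMk_left (measurableSet_before hτ)
  have hsub : Prod.mk ω ⁻¹' before τ ⊆ Prod.mk ω ⁻¹' before σ :=
    fun s hs => lt_of_lt_of_le hs hω
  have htop : before (fun _ : Ω => (⊤ : WithTop ℝ≥0)) = Set.univ := by
    exact Set.eq_univ_of_forall fun x => WithTop.coe_lt_top x.2
  have htot : total (delayFlow πF πB τ) σ ω =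
      ∫ s in Prod.mk ω ⁻¹' (before σ \ before τ), (πF s ω - πB s ω) ∂dt := by
    rw [← integral_indicator (by exact hmσ.diff hmτ)]
    refine integral_congr_ae (ae_of_all _ fun s => ?_)
    by_cases h₁ : (ω, s) ∈ before σ <;> by_cases h₂ : (ω, s) ∈ before τ <;>
      simp [delayFlow, h₁, h₂]
  have hunion : Prod.mk ω ⁻¹' (Set.univ \ before τ) =
      Prod.mk ω ⁻¹' (before σ \ before τ) ∪ Prod.mk ω ⁻¹' (Set.univ \ before σ) := by
    ext s
    have : (ω, s) ∈ before τ → (ω, s) ∈ before σ := fun h => hsub h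
    simp only [Set.mem_preimage, Set.mem_sdiff, Set.mem_univ, true_and, Set.mem_union]
    tauto
  rw [Pi.add_apply, htot, accrued_eq_setIntegral_sdiff, accrued_eq_setIntegral_sdiff,
    accrued_eq_setIntegral_sdiff, htop, hunion,
    setIntegral_union _ (by exact MeasurableSet.univ.diff hmσ) hiB.integrableOn
      hiB.integrableOn, integral_sub hiF.integrableOn hiB.integrableOn]
  · ring
  · exact Set.disjoint_left.2 fun s hs hs' => hs'.2 hs.1

theorem followerReward_ae_eq [IsFiniteMeasure P] {πF πB : ℝ≥0 → Ω → ℝ} (hF : IsRevenue P 𝓕 πF)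
    (hB : IsRevenue P 𝓕 πB) {τ σ : Ω → WithTop ℝ≥0} (hτ : IsStoppingTime 𝓕 τ)
    (hσ : IsAvailable P 𝓕 τ σ) :
    followerReward P πF πB hτ σ =ᵐ[P] P[accrued πB τ (fun _ => ⊤) | hτ.measurableSpace] +
      P[total (delayFlow πF πB τ) σ | hτ.measurableSpace] :=
  (condExp_congr_ae (accrued_add_accrued_ae_eq hF hB hτ hσ)).trans
    (condExp_add (integrable_accrued hB hτ isStoppingTime_top)
      (integrable_total (integrable_delayFlow hF hB hτ) hσ.1) _)

theorem IsEssSup.ae_unique {S : Set (Ω → ℝ)} {V W : Ω → ℝ} (hV : IsEssSup P S V)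
    (hW : IsEssSup P S W) : V =ᵐ[P] W :=
  (hV.2.2 W hW.1 hW.2.1).antisymm (hW.2.2 V hV.1 hV.2.1)

/-- Forwards, conditional inequalities are integrated. Backwards, the reward of a maximal time
dominates all others and belongs to the family, so it is the essential supremum. -/
theorem isOptimalFollowerTime_iff [IsFiniteMeasure P] {πF πB : ℝ≥0 → Ω → ℝ}
    (hF : IsRevenue P 𝓕 πF) (hB : IsRevenue P 𝓕 πB) {τ σ : Ω → WithTop ℝ≥0}
    (hτ : IsStoppingTime 𝓕 τ) :
    IsOptimalFollowerTime P πF πB hτ σ ↔ IsMaximal P 𝓕 (delayFlow πF πB τ) τ σ := by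
  have hH := integrable_delayFlow hF hB hτ
  have hm := hτ.measurableSpace_le
  constructor
  · rintro ⟨hσ, hτσ, -, hub, -⟩
    refine ⟨⟨hσ, hτσ⟩, fun ρ hρ => ?_⟩
    rw [← integral_total hH hρ.1, ← integral_total hH hσ, ← integral_condExp hm,
      ← integral_condExp hm (f := total (delayFlow πF πB τ) σ)]
    refine integral_mono_ae integrable_condExp integrable_condExp ?_
    filter_upwards [hub _ ⟨ρ, hρ.1, hρ.2, rfl⟩, followerReward_ae_eq hF hB hτ hρ,
      followerReward_ae_eq hF hB hτ ⟨hσ, hτσ⟩] with ω h h₁ h₂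
    rw [h₁, h₂] at h
    simpa using h
  · intro h
    refine ⟨h.1.1, h.1.2, (stronglyMeasurable_condExp.mono hm).measurable.aemeasurable, ?_,
      fun W _ hW => hW _ ⟨σ, h.1.1, h.1.2, rfl⟩⟩
    rintro _ ⟨ρ, hρ, hτρ, rfl⟩
    filter_upwards [h.condExp_total_le hH hτ ⟨hρ, hτρ⟩,
      followerReward_ae_eq hF hB hτ ⟨hρ, hτρ⟩, followerReward_ae_eq hF hB hτ h.1]
      with ω hle h₁ h₂
    rw [h₁, h₂]
    simpa using hle

theorem exists_isLatestFollowerTime [IsFiniteMeasure P] (h𝓕 : 𝓕.IsRightContinuous)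
    {πF πB : ℝ≥0 → Ω → ℝ} (hF : IsRevenue P 𝓕 πF) (hB : IsRevenue P 𝓕 πB)
    {τ : Ω → WithTop ℝ≥0} (hτ : IsStoppingTime 𝓕 τ) :
    ∃ σ, IsLatestFollowerTime P πF πB hτ σ := by
  obtain ⟨σ, hσ, hmax⟩ := exists_greatest_isMaximal h𝓕 (integrable_delayFlow hF hB hτ) hτ
  exact ⟨σ, (isOptimalFollowerTime_iff hF hB hτ).2 hσ,
    fun ρ hρ => hmax ρ ((isOptimalFollowerTime_iff hF hB hτ).1 hρ)⟩

/-- The value of a follower's option to delay investment. -/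
theorem IsFollowerPayoff.sub_simultaneousPayoff_ae_eq [IsFiniteMeasure P]
    {π0 πF πB : ℝ≥0 → Ω → ℝ} (hF : IsRevenue P 𝓕 πF) (hB : IsRevenue P 𝓕 πB)
    {τ σ : Ω → WithTop ℝ≥0} (hτ : IsStoppingTime 𝓕 τ) {Z : Ω → ℝ}
    (hZ : IsFollowerPayoff P π0 πF πB hτ Z) (hσ : IsOptimalFollowerTime P πF πB hτ σ) :
    (fun ω => Z ω - simultaneousPayoff P π0 πB hτ ω) =ᵐ[P]
      P[total (delayFlow πF πB τ) σ | hτ.measurableSpace] := by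
  obtain ⟨V, hV, hZV⟩ := hZ
  filter_upwards [hZV, hV.ae_unique hσ.2.2, followerReward_ae_eq hF hB hτ ⟨hσ.1, hσ.2.1⟩]
    with ω h₁ h₂ h₃
  rw [h₁, h₂, h₃, simultaneousPayoff, Pi.add_apply]
  ring

theorem delayFlow_mono {πF₁ πB₁ πF₂ πB₂ : ℝ≥0 → Ω → ℝ}
    (h : ∀ᵐ x : Ω × ℝ≥0 ∂(P.prod dt), πB₂ x.2 x.1 - πF₂ x.2 x.1 ≤ πB₁ x.2 x.1 - πF₁ x.2 x.1)
    (τ : Ω → WithTop ℝ≥0) : delayFlow πF₁ πB₁ τ ≤ᵐ[P.prod dt] delayFlow πF₂ πB₂ τ := by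
  filter_upwards [h] with x hx
  exact Set.indicator_le_indicator (by linarith)

theorem total_mono [SFinite P] {H₁ H₂ : Ω × ℝ≥0 → ℝ} (hH₁ : Integrable H₁ (P.prod dt))
    (hH₂ : Integrable H₂ (P.prod dt)) (hle : H₁ ≤ᵐ[P.prod dt] H₂) {σ : Ω → WithTop ℝ≥0}
    (hσ : IsStoppingTime 𝓕 σ) : total H₁ σ ≤ᵐ[P] total H₂ σ := by
  have hs := measurableSet_before hσ
  filter_upwards [Measure.ae_ae_of_ae_prod hle, (hH₁.indicator hs).prod_right_ae,
    (hH₂.indicator hs).prod_right_ae] with ω h h₁ h₂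
  refine integral_mono_ae h₁ h₂ ?_
  filter_upwards [h] with s h
  exact Set.indicator_le_indicator h

end InvestmentGame

end

theorem lemma1 {Ω : Type*} {m : MeasurableSpace Ω} (P : Measure Ω) [IsProbabilityMeasure P]
    (𝓕 : Filtration ℝ≥0 m) (h𝓕 : InvestmentGame.UsualConditions P 𝓕)
    -- the revenue processes of firm 1 (`i = 0`) and firm 2 (`i = 1`)
    (π0 πF πB : Fin 2 → ℝ≥0 → Ω → ℝ)
    (h0 : ∀ i, InvestmentGame.IsRevenue P 𝓕 (π0 i))
    (hF : ∀ i, InvestmentGame.IsRevenue P 𝓕 (πF i))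
    (hB : ∀ i, InvestmentGame.IsRevenue P 𝓕 (πB i))
    -- firm 2 gains at most as much from investing as a follower as firm 1
    (hBF : ∀ᵐ x : Ω × ℝ≥0 ∂(P.prod InvestmentGame.dt),
      πB 1 x.2 x.1 - πF 1 x.2 x.1 ≤ πB 0 x.2 x.1 - πF 0 x.2 x.1)
    (τ : Ω → WithTop ℝ≥0) (hτ : IsStoppingTime 𝓕 τ) :
    -- the latest optimal follower times and the follower payoffs exist
    (∀ i, ∃ σ, InvestmentGame.IsLatestFollowerTime P (πF i) (πB i) hτ σ) ∧
    (∀ i, ∃ Z, InvestmentGame.IsFollowerPayoff P (π0 i) (πF i) (πB i) hτ Z) ∧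
    -- comparison of the latest optimal follower times
    (∀ σ₁ σ₂ : Ω → WithTop ℝ≥0,
      InvestmentGame.IsLatestFollowerTime P (πF 0) (πB 0) hτ σ₁ →
      InvestmentGame.IsLatestFollowerTime P (πF 1) (πB 1) hτ σ₂ → σ₁ ≤ᵐ[P] σ₂) ∧
    -- comparison of the follower option values
    (∀ F₁ F₂ : Ω → ℝ,
      InvestmentGame.IsFollowerPayoff P (π0 0) (πF 0) (πB 0) hτ F₁ →
      InvestmentGame.IsFollowerPayoff P (π0 1) (πF 1) (πB 1) hτ F₂ →
      ∀ᵐ ω ∂P, F₁ ω - InvestmentGame.simultaneousPayoff P (π0 0) (πB 0) hτ ω ≤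
        F₂ ω - InvestmentGame.simultaneousPayoff P (π0 1) (πB 1) hτ ω) := by
  have hRC := h𝓕.rightContinuous
  have hH := fun i => InvestmentGame.integrable_delayFlow (hF i) (hB i) hτ
  have hmono := InvestmentGame.delayFlow_mono hBF τ
  have hlatest := fun i => InvestmentGame.exists_isLatestFollowerTime hRC (hF i) (hB i) hτ
  have hopt := fun i σ => InvestmentGame.isOptimalFollowerTime_iff (σ := σ) (hF i) (hB i) hτ
  refine ⟨hlatest, fun i => ?_, fun σ₁ σ₂ h₁ h₂ => ?_, fun F₁ F₂ hF₁ hF₂ => ?_⟩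
  · obtain ⟨σ, hσ⟩ := hlatest i
    exact ⟨_, _, hσ.1.2.2, Filter.EventuallyEq.rfl⟩
  -- The maximum of `σ₁` and `σ₂` is optimal for firm 2, so `σ₂`, being latest, dominates it.
  · filter_upwards [h₂.2 _ ((hopt 1 _).2 (((hopt 0 _).1 h₁.1).sup_of_le (hH 0) (hH 1) hmono
      ((hopt 1 _).1 h₂.1)))] with ω h
    exact le_sup_left.trans h
  · obtain ⟨σ₁, h₁⟩ := hlatest 0
    obtain ⟨σ₂, h₂⟩ := hlatest 1
    -- Firm 2 gains at least firm 1's option value by imitating `σ₁`, and no less by using `σ₂`.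
    filter_upwards [hF₁.sub_simultaneousPayoff_ae_eq (hF 0) (hB 0) hτ h₁.1,
      hF₂.sub_simultaneousPayoff_ae_eq (hF 1) (hB 1) hτ h₂.1,
      condExp_mono (m := hτ.measurableSpace)
        (InvestmentGame.integrable_total (hH 0) h₁.1.1)
        (InvestmentGame.integrable_total (hH 1) h₁.1.1)
        (InvestmentGame.total_mono (hH 0) (hH 1) hmono h₁.1.1),
      ((hopt 1 _).1 h₂.1).condExp_total_le (hH 1) hτ ⟨h₁.1.1, h₁.1.2.1⟩] with ω e₁ e₂ l₁ l₂
    rw [e₁, e₂]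
    exact l₁.trans l₂
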